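/- All vector spaces are over $\mathbb{C}$. A Leibniz superalgebra of type $(n,m)$ is a $\mathbb{Z}_2$-graded space $L=L_0\oplus L_1$ with $\dim L_0=n$, $\dim L_1=m$ and a bilinear product with $[L_\alpha,L_\beta]\subseteq L_{\alpha+\beta}$ and $$[x,[y,z]]=[[x,y],z]-(-1)^{\alpha\beta}[[x,z],y]\qquad (x\in L,\ y\in L_\alpha,\ z\in L_\beta);$$ it is a Lie superalgebra if moreover $[x,y]=-(-1)^{\alpha\beta}[y,x]$ for $x\in L_\alpha$, $y\in L_\beta$. Put $C^0(L)=L$, $C^{k+1}(L)=[C^k(L),L]$; $L$ is nilpotent if $C^k(L)=0$ for some $k$, and the least such $k$ is its nilindex. Let $N^{n,m}$ be the set of nilpotent Leibniz superalgebras of type $(n,m)$, let $f(n,m)$ be the maximal nilindex occurring in $N^{n,m}$, and let $\mathcal{M}^{n,m}\subseteq N^{n,m}$ be the set of those with nilindex $f(n,m)$. Put $C^0(L_i)=L_i$, $C^{k+1}(L_i)=[C^k(L_i),L_0]$ for $i\in\{0,1\}$, and let $\mathcal{ZF}^{n,m}\subseteq N^{n,m}$ be the set of zero-filiform ones, that is,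 those for which $n$ is the least $k$ with $C^k(L_0)=0$ and $m$ is the least $k$ with $C^k(L_1)=0$. For odd $m$ let $K^{2,m}$ be the superalgebra with even basis $X_0,X_1$, odd basis $Y_1,\dots,Y_m$ and nonzero products $$[X_0,Y_i]=-[Y_i,X_0]=Y_{i+1}\ (1\le i\le m-1),\qquad [Y_i,Y_{m+1-i}]=(-1)^{i+1}X_1\ (1\le i\le m).$$ **Theorem.** If $m\ge 5$, then $\mathcal{M}^{2,m}\not\subset\mathcal{ZF}^{2,m}$. More precisely, if $m$ is odd, then $K^{2,m}$ is a Lie superalgebra that belongs to $\mathcal{M}^{2,m}$ and not to $\mathcal{ZF}^{2,m}$; if $m$ is even, then $K^{2,m-1}\oplus\mathbb{C}$, where $\mathbb{C}$ is the one-dimensional purely odd superalgebra with zero product, belongs (up to isomorphism) to $\mathcal{M}^{2,m}$ and not to $\mathcal{ZF}^{2,m}$. -/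

import Mathlib

noncomputable section

namespace LeibnizSuper

/-- Bilinear products ("laws") on the `ℤ/2`-graded complex vector space `V₀ ⊕ V₁`; the product
of `x` and `y` is `μ x y`. -/
abbrev Law (V₀ V₁ : Type) [AddCommGroup V₀] [Module ℂ V₀] [AddCommGroup V₁] [Module ℂ V₁] : Type :=
  (V₀ × V₁) →ₗ[ℂ] (V₀ × V₁) →ₗ[ℂ] (V₀ × V₁)

section General

variable {V₀ V₁ : Type} [AddCommGroup V₀] [Module ℂ V₀] [AddCommGroup V₁] [Module ℂ V₁]
variable {W₀ W₁ : Type} [AddCommGroup W₀] [Module ℂ W₀] [AddCommGroup W₁] [Module ℂ W₁]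

/-- The homogeneous component of degree `α ∈ ℤ/2`: `V₀` for `α = 0` and `V₁` for `α = 1`. -/
def part (V₀ V₁ : Type) [AddCommGroup V₀] [Module ℂ V₀] [AddCommGroup V₁] [Module ℂ V₁]
    (α : ZMod 2) : Submodule ℂ (V₀ × V₁) :=
  if α = 0 then LinearMap.range (LinearMap.inl ℂ V₀ V₁) else LinearMap.range (LinearMap.inr ℂ V₀ V₁)

/-- The sign `(-1)^{αβ}` for degrees `α, β ∈ ℤ/2`. -/
def sgn (α β : ZMod 2) : ℂ := (-1) ^ (α.val * β.val)

/-- Leibniz superalgebra laws: the product respects the grading and satisfies the graded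
(right) Leibniz identity. -/
structure IsLeibniz (μ : Law V₀ V₁) : Prop where
  grading : ∀ (α β : ZMod 2) (x y : V₀ × V₁), x ∈ part V₀ V₁ α → y ∈ part V₀ V₁ β →
    μ x y ∈ part V₀ V₁ (α + β)
  identity : ∀ (α β : ZMod 2) (x y z : V₀ × V₁), y ∈ part V₀ V₁ α → z ∈ part V₀ V₁ β →
    μ x (μ y z) = μ (μ x y) z - sgn α β • μ (μ x z) y

/-- Lie superalgebras are the Leibniz superalgebras with `[x, y] = -(-1)^{αβ} [y, x]`. -/
structure IsLie (μ : Law V₀ V₁) : Prop extends IsLeibniz μ where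
  skew : ∀ (α β : ZMod 2) (x y : V₀ × V₁), x ∈ part V₀ V₁ α → y ∈ part V₀ V₁ β →
    μ x y = -(sgn α β • μ y x)

/-- Starting from a subspace `A`, multiply repeatedly by a subspace `B` on the right:
`A, [A, B], [[A, B], B], …` (each `[·, ·]` is the linear span of the products). -/
def rightSeq (μ : Law V₀ V₁) (A B : Submodule ℂ (V₀ × V₁)) : ℕ → Submodule ℂ (V₀ × V₁)
  | 0 => A
  | k + 1 => Submodule.map₂ μ (rightSeq μ A B k) B

/-- The descending central sequence `C⁰(L) = L`, `Cᵏ⁺¹(L) = [Cᵏ(L), L]`. -/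
def lowerCentral (μ : Law V₀ V₁) (k : ℕ) : Submodule ℂ (V₀ × V₁) :=
  rightSeq μ ⊤ ⊤ k

/-- The sequence `C⁰(Lᵢ) = Lᵢ`, `Cᵏ⁺¹(Lᵢ) = [Cᵏ(Lᵢ), L₀]` for `i ∈ ℤ/2`. -/
def partCentral (μ : Law V₀ V₁) (i : ZMod 2) (k : ℕ) : Submodule ℂ (V₀ × V₁) :=
  rightSeq μ (part V₀ V₁ i) (part V₀ V₁ 0) k

def IsNilpotent (μ : Law V₀ V₁) : Prop := ∃ k, lowerCentral μ k = ⊥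

/-- The smallest `k` with `Cᵏ(L) = 0`; used only for nilpotent laws. -/
def nilindex (μ : Law V₀ V₁) : ℕ := sInf {k | lowerCentral μ k = ⊥}

/-- `L` has super-nilindex `(p, q)`: `p` and `q` are the first indices at which `Cᵖ(L₀)` and
`C^q(L₁)` vanish, so that `C^{p-1}(L₀) ≠ 0`, `C^{q-1}(L₁) ≠ 0`, `Cᵖ(L₀) = C^q(L₁) = 0`. -/
def HasSNilindex (μ : Law V₀ V₁) (p q : ℕ) : Prop :=
  IsLeast {k | partCentral μ 0 k = ⊥} p ∧ IsLeast {k | partCentral μ 1 k = ⊥} q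

/-- Isomorphism of superalgebras: an even linear isomorphism that preserves the products. -/
def Isomorphic (μ : Law V₀ V₁) (ν : Law W₀ W₁) : Prop :=
  ∃ (f₀ : V₀ ≃ₗ[ℂ] W₀) (f₁ : V₁ ≃ₗ[ℂ] W₁), ∀ x y : V₀ × V₁,
    (f₀.prodCongr f₁) (μ x y) = ν ((f₀.prodCongr f₁) x) ((f₀.prodCongr f₁) y)

/-- The direct sum of two superalgebras, with even part `V₀ ⊕ W₀` and odd part `V₁ ⊕ W₁`,
and with the componentwise product. -/
def directSum (μ : Law V₀ V₁) (ν : Law W₀ W₁) : Law (V₀ × W₀) (V₁ × W₁) :=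
  LinearMap.mk₂ ℂ
    (fun a b =>
      let u := μ (a.1.1, a.2.1) (b.1.1, b.2.1)
      let v := ν (a.1.2, a.2.2) (b.1.2, b.2.2)
      ((u.1, v.1), (u.2, v.2)))
    (fun a a' b => by
      have h₁ := μ.map_add₂ (a.1.1, a.2.1) (a'.1.1, a'.2.1) (b.1.1, b.2.1)
      have h₂ := ν.map_add₂ (a.1.2, a.2.2) (a'.1.2, a'.2.2) (b.1.2, b.2.2)
      simp only [Prod.mk_add_mk] at h₁ h₂
      simp [h₁, h₂])
    (fun c a b => by
      have h₁ := μ.map_smul₂ c (a.1.1, a.2.1) (b.1.1, b.2.1)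
      have h₂ := ν.map_smul₂ c (a.1.2, a.2.2) (b.1.2, b.2.2)
      simp only [Prod.smul_mk] at h₁ h₂
      simp [h₁, h₂])
    (fun a b b' => by
      have h₁ := (μ (a.1.1, a.2.1)).map_add (b.1.1, b.2.1) (b'.1.1, b'.2.1)
      have h₂ := (ν (a.1.2, a.2.2)).map_add (b.1.2, b.2.2) (b'.1.2, b'.2.2)
      simp only [Prod.mk_add_mk] at h₁ h₂
      simp [h₁, h₂])
    (fun c a b => by
      have h₁ := (μ (a.1.1, a.2.1)).map_smul c (b.1.1, b.2.1)
      have h₂ := (ν (a.1.2, a.2.2)).map_smul c (b.1.2, b.2.2)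
      simp only [Prod.smul_mk] at h₁ h₂
      simp [h₁, h₂])

end General

/-- Laws on the standard graded space with even dimension `n` and odd dimension `m`. -/
abbrev StdLaw (n m : ℕ) : Type := Law (Fin n → ℂ) (Fin m → ℂ)

/-- `N^{n,m}`: nilpotent Leibniz superalgebra laws of type `(n, m)`. -/
def N (n m : ℕ) : Set (StdLaw n m) := {μ | IsLeibniz μ ∧ IsNilpotent μ}

/-- `M^{n,m}`: the elements of `N^{n,m}` whose nilindex is the maximal nilindex `f(n, m)`
occurring in `N^{n,m}`. -/
def M (n m : ℕ) : Set (StdLaw n m) :=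
  {μ | μ ∈ N n m ∧ IsGreatest (nilindex '' N n m) (nilindex μ)}

/-- `ZF^{n,m}`: the zero-filiform elements of `N^{n,m}`, of super-nilindex `(n, m)`. -/
def ZF (n m : ℕ) : Set (StdLaw n m) := {μ | μ ∈ N n m ∧ HasSNilindex μ n m}

/-- The shift `Y₁ ↦ Y₂ ↦ ⋯ ↦ Y_m ↦ 0`, where `Y_{i+1}` is the basis vector with index `i`. -/
def shift (m : ℕ) : (Fin m → ℂ) →ₗ[ℂ] (Fin m → ℂ) where
  toFun y k := ∑ i : Fin m, if (i : ℕ) + 1 = k then y i else 0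
  map_add' y y' := by
    ext k
    simp only [Pi.add_apply, ← Finset.sum_add_distrib]
    exact Finset.sum_congr rfl fun i _ => by split_ifs <;> simp
  map_smul' c y := by
    ext k
    simp only [Pi.smul_apply, smul_eq_mul, RingHom.id_apply, Finset.mul_sum]
    exact Finset.sum_congr rfl fun i _ => by split_ifs <;> simp

/-- The law `K^{2,m}` in the basis `X₀, X₁ | Y₁, …, Y_m`:
`[X₀, Y_i] = -[Y_i, X₀] = Y_{i+1}` for `1 ≤ i ≤ m - 1`, and
`[Y_i, Y_{m+1-i}] = (-1)^{i+1} X₁` for `1 ≤ i ≤ m`; all other products vanish.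
It is meant for odd `m`. -/
def K (m : ℕ) : StdLaw 2 m :=
  LinearMap.mk₂ ℂ
    (fun a b => (Pi.single 1 (∑ i : Fin m, (-1) ^ (i : ℕ) * a.2 i * b.2 i.rev),
      a.1 0 • shift m b.2 - b.1 0 • shift m a.2))
    (fun a a' b => by
      ext k
      · simp only [Prod.fst_add, Prod.snd_add, Pi.add_apply, mul_add, add_mul,
          Finset.sum_add_distrib, Pi.single_add]
      · simp [add_smul]; ring)
    (fun c a b => by
      ext k
      · fin_cases k
        · simp
        · simp only [Fin.mk_one, Pi.single_eq_same, Prod.smul_fst, Prod.smul_snd, Pi.smul_apply,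
            smul_eq_mul, Finset.mul_sum]
          exact Finset.sum_congr rfl fun i _ => by ring
      · simp; ring)
    (fun a b b' => by
      ext k
      · simp only [Prod.fst_add, Prod.snd_add, Pi.add_apply, mul_add,
          Finset.sum_add_distrib, Pi.single_add]
      · simp [add_smul]; ring)
    (fun c a b => by
      ext k
      · fin_cases k
        · simp
        · simp only [Fin.mk_one, Pi.single_eq_same, Prod.smul_fst, Prod.smul_snd, Pi.smul_apply,
            smul_eq_mul, Finset.mul_sum]
          exact Finset.sum_congr rfl fun i _ => by ring
      · simp; ring)

/-- `ℂ` as a purely odd one-dimensional superalgebra with zero product. -/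
def oddLine : StdLaw 0 1 := 0

end LeibnizSuper

end

namespace LeibnizSuper

open Module

/-! ### Parity bookkeeping and the descending central sequence. -/

section Structure

variable {V₀ V₁ : Type} [AddCommGroup V₀] [Module ℂ V₀] [AddCommGroup V₁] [Module ℂ V₁]
variable {μ : Law V₀ V₁}

/-! Failure of zero-filiformity is cheap: even elements of the models multiply to zero, so C¹(L₀) =
0 although dim L₀ = 2. The work lies in showing that the models have maximal nilindex, that is,
Cᵐ⁺¹(L) = 0 for every nilpotent L of type (2,m) with m ≥ 5, and Cᵐ(L) = 0 if m is even.

Assume Cᵐ(L) ≠ 0. There are an even and an odd generator outside C¹, so dim C¹ ≤ m. The strict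
decrease of the sequence then forces Cᵐ⁺¹ = 0 and makes every quotient Cᵏ/Cᵏ⁺¹ with 1 ≤ k ≤ m a line
(`exists_isAdapted`); this already bounds the nilindex by m + 1. A single even vector X₁ spans the
even part of C¹.

For the parity statement, X₁ is pushed down to the last term Cᵐ (`mem_last`), so even elements of C¹
annihilate L on both sides. Hence R = [·, X₀] is skew for the product of odd elements, commutes with
[X₀, ·] on L₁, and Y₁, RY₁, R²Y₁, … runs through the filtration. Comparing the products of Rᵐ⁻²Y₁
and Y₁ with the Leibniz identity gives 2β = 0 for a nonzero β when m is even (`odd_dim`).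

Conversely, K has Cᵐ ≠ 0 because [Y_m, Y₁] = ±X₁. Its Leibniz identity amounts to a pairing that is
symmetric for odd m and for which the shift is skew. -/

theorem mem_part_zero {x : V₀ × V₁} : x ∈ part V₀ V₁ 0 ↔ x.2 = 0 := by
  simp only [part, if_true, LinearMap.mem_range, LinearMap.inl_apply]
  exact ⟨fun ⟨y, hy⟩ => by simp [← hy], fun h => ⟨x.1, by simp [← h]⟩⟩

theorem mem_part_one {x : V₀ × V₁} : x ∈ part V₀ V₁ 1 ↔ x.1 = 0 := by
  simp only [part, one_ne_zero, if_false, LinearMap.mem_range, LinearMap.inr_apply]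
  exact ⟨fun ⟨y, hy⟩ => by simp [← hy], fun h => ⟨x.2, by simp [← h]⟩⟩

@[simp] theorem sgn_zero_left (β : ZMod 2) : sgn 0 β = 1 := by simp [sgn]

@[simp] theorem sgn_zero_right (α : ZMod 2) : sgn α 0 = 1 := by simp [sgn]

@[simp] theorem sgn_one_one : sgn 1 1 = -1 := by simp [sgn, ZMod.val_one]

theorem zmod_two_cases (α : ZMod 2) : α = 0 ∨ α = 1 := by
  revert α; decide

/-- The grading and identity axioms spelled out by parity. -/
theorem isLeibniz_iff : IsLeibniz μ ↔
    ((∀ x y : V₀ × V₁, x.2 = 0 → y.2 = 0 → (μ x y).2 = 0) ∧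
      (∀ x y : V₀ × V₁, x.2 = 0 → y.1 = 0 → (μ x y).1 = 0) ∧
      (∀ x y : V₀ × V₁, x.1 = 0 → y.2 = 0 → (μ x y).1 = 0) ∧
      (∀ x y : V₀ × V₁, x.1 = 0 → y.1 = 0 → (μ x y).2 = 0)) ∧
    (∀ x y z : V₀ × V₁, y.2 = 0 → z.2 = 0 → μ x (μ y z) = μ (μ x y) z - μ (μ x z) y) ∧
    (∀ x y z : V₀ × V₁, y.2 = 0 → z.1 = 0 → μ x (μ y z) = μ (μ x y) z - μ (μ x z) y) ∧
    (∀ x y z : V₀ × V₁, y.1 = 0 → z.2 = 0 → μ x (μ y z) = μ (μ x y) z - μ (μ x z) y) ∧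
    (∀ x y z : V₀ × V₁, y.1 = 0 → z.1 = 0 → μ x (μ y z) = μ (μ x y) z + μ (μ x z) y) := by
  constructor
  · intro h
    refine ⟨⟨fun x y hx hy => ?_, fun x y hx hy => ?_, fun x y hx hy => ?_, fun x y hx hy => ?_⟩,
      fun x y z hy hz => ?_, fun x y z hy hz => ?_, fun x y z hy hz => ?_, fun x y z hy hz => ?_⟩
    · exact mem_part_zero.1 (by simpa using h.grading 0 0 x y (mem_part_zero.2 hx) (mem_part_zero.2 hy))
    · exact mem_part_one.1 (by simpa using h.grading 0 1 x y (mem_part_zero.2 hx) (mem_part_one.2 hy))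
    · exact mem_part_one.1 (by simpa using h.grading 1 0 x y (mem_part_one.2 hx) (mem_part_zero.2 hy))
    · exact mem_part_zero.1 (h.grading 1 1 x y (mem_part_one.2 hx) (mem_part_one.2 hy))
    · simpa using h.identity 0 0 x y z (mem_part_zero.2 hy) (mem_part_zero.2 hz)
    · simpa using h.identity 0 1 x y z (mem_part_zero.2 hy) (mem_part_one.2 hz)
    · simpa using h.identity 1 0 x y z (mem_part_one.2 hy) (mem_part_zero.2 hz)
    · simpa using h.identity 1 1 x y z (mem_part_one.2 hy) (mem_part_one.2 hz)
  · rintro ⟨⟨g00, g01, g10, g11⟩, i00, i01, i10, i11⟩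
    constructor
    · intro α β x y hx hy
      rcases zmod_two_cases α with rfl | rfl <;> rcases zmod_two_cases β with rfl | rfl
      · simpa using mem_part_zero.2 (g00 x y (mem_part_zero.1 hx) (mem_part_zero.1 hy))
      · simpa using mem_part_one.2 (g01 x y (mem_part_zero.1 hx) (mem_part_one.1 hy))
      · simpa using mem_part_one.2 (g10 x y (mem_part_one.1 hx) (mem_part_zero.1 hy))
      · exact mem_part_zero.2 (g11 x y (mem_part_one.1 hx) (mem_part_one.1 hy))
    · intro α β x y z hy hz
      rcases zmod_two_cases α with rfl | rfl <;> rcases zmod_two_cases β with rfl | rfl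
      · simpa using i00 x y z (mem_part_zero.1 hy) (mem_part_zero.1 hz)
      · simpa using i01 x y z (mem_part_zero.1 hy) (mem_part_one.1 hz)
      · simpa using i10 x y z (mem_part_one.1 hy) (mem_part_zero.1 hz)
      · simpa using i11 x y z (mem_part_one.1 hy) (mem_part_one.1 hz)

namespace IsLeibniz

theorem even_even (h : IsLeibniz μ) {x y : V₀ × V₁} (hx : x.2 = 0) (hy : y.2 = 0) :
    (μ x y).2 = 0 := (isLeibniz_iff.1 h).1.1 x y hx hy

theorem even_odd (h : IsLeibniz μ) {x y : V₀ × V₁} (hx : x.2 = 0) (hy : y.1 = 0) :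
    (μ x y).1 = 0 := (isLeibniz_iff.1 h).1.2.1 x y hx hy

theorem odd_even (h : IsLeibniz μ) {x y : V₀ × V₁} (hx : x.1 = 0) (hy : y.2 = 0) :
    (μ x y).1 = 0 := (isLeibniz_iff.1 h).1.2.2.1 x y hx hy

theorem odd_odd (h : IsLeibniz μ) {x y : V₀ × V₁} (hx : x.1 = 0) (hy : y.1 = 0) :
    (μ x y).2 = 0 := (isLeibniz_iff.1 h).1.2.2.2 x y hx hy

theorem identity_even_even (h : IsLeibniz μ) (x : V₀ × V₁) {y z : V₀ × V₁} (hy : y.2 = 0)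
    (hz : z.2 = 0) : μ x (μ y z) = μ (μ x y) z - μ (μ x z) y :=
  (isLeibniz_iff.1 h).2.1 x y z hy hz

theorem identity_even_odd (h : IsLeibniz μ) (x : V₀ × V₁) {y z : V₀ × V₁} (hy : y.2 = 0)
    (hz : z.1 = 0) : μ x (μ y z) = μ (μ x y) z - μ (μ x z) y :=
  (isLeibniz_iff.1 h).2.2.1 x y z hy hz

theorem identity_odd_even (h : IsLeibniz μ) (x : V₀ × V₁) {y z : V₀ × V₁} (hy : y.1 = 0)
    (hz : z.2 = 0) : μ x (μ y z) = μ (μ x y) z - μ (μ x z) y :=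
  (isLeibniz_iff.1 h).2.2.2.1 x y z hy hz

theorem identity_odd_odd (h : IsLeibniz μ) (x : V₀ × V₁) {y z : V₀ × V₁} (hy : y.1 = 0)
    (hz : z.1 = 0) : μ x (μ y z) = μ (μ x y) z + μ (μ x z) y :=
  (isLeibniz_iff.1 h).2.2.2.2 x y z hy hz

end IsLeibniz

/-- The even component. -/
abbrev ev (x : V₀ × V₁) : V₀ × V₁ := (x.1, 0)

/-- The odd component. -/
abbrev od (x : V₀ × V₁) : V₀ × V₁ := (0, x.2)

set_option linter.unusedSectionVars false in
theorem ev_add_od (x : V₀ × V₁) : ev x + od x = x := by simp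

set_option linter.unusedSectionVars false in
theorem ev_of_even {x : V₀ × V₁} (h : x.2 = 0) : ev x = x := Prod.ext rfl h.symm

set_option linter.unusedSectionVars false in
theorem od_of_odd {x : V₀ × V₁} (h : x.1 = 0) : od x = x := Prod.ext h.symm rfl

theorem mul_split (x y : V₀ × V₁) :
    μ x y = μ (ev x) (ev y) + μ (od x) (od y) + (μ (ev x) (od y) + μ (od x) (ev y)) := by
  conv_lhs => rw [← ev_add_od x, ← ev_add_od y]
  simp only [map_add, LinearMap.add_apply]
  abel

theorem IsLeibniz.ev_mul (h : IsLeibniz μ) (x y : V₀ × V₁) :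
    ev (μ x y) = μ (ev x) (ev y) + μ (od x) (od y) := by
  have h1 : (μ (ev x) (od y)).1 = 0 := h.even_odd rfl rfl
  have h2 : (μ (od x) (ev y)).1 = 0 := h.odd_even rfl rfl
  have h3 : (μ (ev x) (ev y)).2 = 0 := h.even_even rfl rfl
  have h4 : (μ (od x) (od y)).2 = 0 := h.odd_odd rfl rfl
  rw [mul_split x y]
  ext1
  · simp [ev, h1, h2]
  · simp [ev, h3, h4]

theorem IsLeibniz.od_mul (h : IsLeibniz μ) (x y : V₀ × V₁) :
    od (μ x y) = μ (ev x) (od y) + μ (od x) (ev y) := by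
  have h1 : (μ (ev x) (od y)).1 = 0 := h.even_odd rfl rfl
  have h2 : (μ (od x) (ev y)).1 = 0 := h.odd_even rfl rfl
  have h3 : (μ (ev x) (ev y)).2 = 0 := h.even_even rfl rfl
  have h4 : (μ (od x) (od y)).2 = 0 := h.odd_odd rfl rfl
  rw [mul_split x y]
  ext1
  · simp [od, h1, h2]
  · simp [od, h3, h4]

local notation "C" => lowerCentral μ

theorem mul_mem_lowerCentral_succ {k : ℕ} {x : V₀ × V₁} (hx : x ∈ C k) (y : V₀ × V₁) :
    μ x y ∈ C (k + 1) :=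
  Submodule.apply_mem_map₂ _ hx Submodule.mem_top

theorem lowerCentral_succ_le_of {k : ℕ} {P : Submodule ℂ (V₀ × V₁)}
    (h : ∀ x ∈ C k, ∀ y, μ x y ∈ P) : C (k + 1) ≤ P :=
  Submodule.map₂_le.2 fun x hx y _ => h x hx y

theorem lowerCentral_succ_le (k : ℕ) : C (k + 1) ≤ C k := by
  induction k with
  | zero => exact le_top
  | succ k ih => exact lowerCentral_succ_le_of fun x hx y => mul_mem_lowerCentral_succ (ih hx) y

theorem lowerCentral_antitone : Antitone (lowerCentral μ) :=
  antitone_nat_of_succ_le lowerCentral_succ_le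

/-- The terms of the descending central sequence are graded. -/
theorem IsLeibniz.components_mem (h : IsLeibniz μ) (k : ℕ) :
    ∀ x ∈ C k, ev x ∈ C k ∧ od x ∈ C k := by
  induction k with
  | zero => exact fun x _ => ⟨trivial, trivial⟩
  | succ k ih =>
    intro x hx
    have hle : C (k + 1) ≤
        (C (k + 1)).comap ((LinearMap.inl ℂ V₀ V₁).comp (LinearMap.fst ℂ V₀ V₁)) ⊓
        (C (k + 1)).comap ((LinearMap.inr ℂ V₀ V₁).comp (LinearMap.snd ℂ V₀ V₁)) := by
      refine lowerCentral_succ_le_of fun a ha b => ?_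
      obtain ⟨h0, h1⟩ := ih a ha
      refine ⟨?_, ?_⟩
      · change ev (μ a b) ∈ C (k + 1)
        rw [h.ev_mul]
        exact add_mem (mul_mem_lowerCentral_succ h0 _) (mul_mem_lowerCentral_succ h1 _)
      · change od (μ a b) ∈ C (k + 1)
        rw [h.od_mul]
        exact add_mem (mul_mem_lowerCentral_succ h0 _) (mul_mem_lowerCentral_succ h1 _)
    exact hle hx

theorem IsLeibniz.ev_mem (h : IsLeibniz μ) {k : ℕ} {x : V₀ × V₁} (hx : x ∈ C k) : ev x ∈ C k :=
  (h.components_mem k x hx).1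

theorem IsLeibniz.od_mem (h : IsLeibniz μ) {k : ℕ} {x : V₀ × V₁} (hx : x ∈ C k) : od x ∈ C k :=
  (h.components_mem k x hx).2

/-- `[Cⁱ(L), Cʲ(L)] ⊆ Cⁱ⁺ʲ⁺¹(L)`. -/
theorem IsLeibniz.mul_mem_lowerCentral (h : IsLeibniz μ) (j : ℕ) :
    ∀ (i : ℕ) {x y : V₀ × V₁}, x ∈ C i → y ∈ C j → μ x y ∈ C (i + j + 1) := by
  induction j with
  | zero => exact fun i x y hx _ => mul_mem_lowerCentral_succ hx y
  | succ j ih =>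
    intro i x y hx hy
    suffices hle : C (j + 1) ≤ (C (i + (j + 1) + 1)).comap (μ x) from hle hy
    refine lowerCentral_succ_le_of fun a ha b => ?_
    -- These are the two terms of the Leibniz identity for [x, [a, b]]. In the second, x is first
    -- moved to Cⁱ⁺¹, so the induction hypothesis is needed for all i.
    have key : ∀ a b : V₀ × V₁, a ∈ C j →
        μ (μ x a) b ∈ C (i + (j + 1) + 1) ∧ μ (μ x b) a ∈ C (i + (j + 1) + 1) := by
      intro a b ha
      refine ⟨mul_mem_lowerCentral_succ (ih i hx ha) b, ?_⟩
      have := ih (i + 1) (mul_mem_lowerCentral_succ hx b) ha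
      rwa [show i + 1 + j + 1 = i + (j + 1) + 1 by ring] at this
    have ha0 := h.ev_mem ha
    have ha1 := h.od_mem ha
    rw [Submodule.mem_comap, mul_split a b]
    simp only [map_add]
    rw [h.identity_even_even x (y := ev a) (z := ev b) rfl rfl,
      h.identity_odd_odd x (y := od a) (z := od b) rfl rfl,
      h.identity_even_odd x (y := ev a) (z := od b) rfl rfl,
      h.identity_odd_even x (y := od a) (z := ev b) rfl rfl]
    exact add_mem (add_mem (sub_mem (key _ _ ha0).1 (key _ _ ha0).2)
      (add_mem (key _ _ ha1).1 (key _ _ ha1).2))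
      (add_mem (sub_mem (key _ _ ha0).1 (key _ _ ha0).2) (sub_mem (key _ _ ha1).1 (key _ _ ha1).2))

theorem IsLeibniz.mul_mem_of_le (h : IsLeibniz μ) {i j k : ℕ} {x y : V₀ × V₁} (hx : x ∈ C i)
    (hy : y ∈ C j) (hk : k ≤ i + j + 1) : μ x y ∈ C k :=
  lowerCentral_antitone hk (h.mul_mem_lowerCentral j i hx hy)

/-- In a nilpotent superalgebra the descending central sequence decreases strictly until it
vanishes. -/
theorem IsNilpotent.not_le_succ (hn : IsNilpotent μ) {k : ℕ} (hk : C k ≠ ⊥) :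
    ¬ C k ≤ C (k + 1) := by
  intro hle
  have hall : ∀ j, C k ≤ C (k + j) := by
    intro j
    induction j with
    | zero => exact le_rfl
    | succ j ih =>
      refine hle.trans ?_
      exact lowerCentral_succ_le_of fun x hx y => mul_mem_lowerCentral_succ (ih hx) y
  obtain ⟨n, hn⟩ := hn
  exact hk (le_bot_iff.1 (hn ▸ (hall n).trans (lowerCentral_antitone (by omega))))

theorem IsNilpotent.lt_succ (hn : IsNilpotent μ) {k : ℕ} (hk : C k ≠ ⊥) :
    C (k + 1) < C k :=
  lt_of_le_not_ge (lowerCentral_succ_le k) (hn.not_le_succ hk)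

theorem lowerCentral_ne_bot_of_le {j k : ℕ} (hjk : j ≤ k) (hk : C k ≠ ⊥) : C j ≠ ⊥ :=
  fun h => hk (le_bot_iff.1 (h ▸ lowerCentral_antitone hjk))

theorem lowerCentral_eq_bot_of_nilindex_le (hn : IsNilpotent μ) {k : ℕ} (hk : nilindex μ ≤ k) :
    C k = ⊥ := by
  have h : C (nilindex μ) = ⊥ := Nat.sInf_mem (s := {k | lowerCentral μ k = ⊥}) hn
  exact le_bot_iff.1 (h ▸ lowerCentral_antitone hk)

theorem lt_nilindex (hn : IsNilpotent μ) {k : ℕ} (hk : C k ≠ ⊥) : k < nilindex μ := by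
  by_contra! h
  exact hk (lowerCentral_eq_bot_of_nilindex_le hn h)

theorem nilindex_le {k : ℕ} (hk : C k = ⊥) : nilindex μ ≤ k :=
  Nat.sInf_le hk

end Structure

/-! ### Generators and dimension count. -/

section UpperBound

variable {V₀ V₁ : Type} [AddCommGroup V₀] [Module ℂ V₀] [AddCommGroup V₁] [Module ℂ V₁]
variable {μ : Law V₀ V₁}

local notation "C" => lowerCentral μ

/-- The odd part of a nilpotent superalgebra is not contained in the derived superalgebra. -/
theorem IsLeibniz.exists_odd_generator (h : IsLeibniz μ) (hn : IsNilpotent μ) [Nontrivial V₁] :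
    ∃ y : V₀ × V₁, y.1 = 0 ∧ y ∉ C 1 := by
  by_contra! hcon
  have hall : ∀ k, ∀ y : V₀ × V₁, y.1 = 0 → y ∈ C (k + 1) := by
    intro k
    induction k with
    | zero => exact hcon
    | succ k ih =>
      -- The odd component of a product always has an odd factor, which already lies in Cᵏ⁺¹.
      have hle : C 1 ≤
          (C (k + 1 + 1)).comap ((LinearMap.inr ℂ V₀ V₁).comp (LinearMap.snd ℂ V₀ V₁)) := by
        refine lowerCentral_succ_le_of fun a _ b => ?_
        change od (μ a b) ∈ C (k + 1 + 1)
        rw [h.od_mul]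
        exact add_mem (h.mul_mem_of_le (i := 0) (j := k + 1) trivial (ih _ rfl) (by omega))
          (mul_mem_lowerCentral_succ (ih _ rfl) _)
      intro y hy
      rw [← od_of_odd hy]
      exact hle (hcon y hy)
  obtain ⟨n, hn⟩ := hn
  obtain ⟨v, hv⟩ := exists_ne (0 : V₁)
  have h1 : ((0 : V₀), v) ∈ C n := lowerCentral_antitone (by omega) (hall n (0, v) rfl)
  rw [hn, Submodule.mem_bot] at h1
  exact hv (congrArg Prod.snd h1)

/-- If L₀ ⊆ C¹, an even right factor advances the filtration by two steps, so modulo Cᵏ⁺² only odd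
right factors contribute to Cᵏ⁺¹. Each step thus flips the parity of Cᵏ/Cᵏ⁺¹, starting from a purely
odd L/C¹. -/
theorem IsLeibniz.parity_of_even_le (h : IsLeibniz μ) (h0 : ∀ x : V₀ × V₁, x.2 = 0 → x ∈ C 1)
    (k : ℕ) : (∀ x ∈ C (2 * k), ev x ∈ C (2 * k + 1)) ∧
      (∀ x ∈ C (2 * k + 1), od x ∈ C (2 * k + 2)) := by
  have step1 : ∀ k, (∀ x ∈ C k, ev x ∈ C (k + 1)) → ∀ x ∈ C (k + 1), od x ∈ C (k + 2) := by
    intro k hk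
    have hle : C (k + 1) ≤
        (C (k + 2)).comap ((LinearMap.inr ℂ V₀ V₁).comp (LinearMap.snd ℂ V₀ V₁)) := by
      refine lowerCentral_succ_le_of fun a ha b => ?_
      change od (μ a b) ∈ C (k + 2)
      rw [h.od_mul]
      exact add_mem (mul_mem_lowerCentral_succ (hk a ha) _)
        (h.mul_mem_of_le (h.od_mem ha) (h0 (ev b) rfl) (by omega))
    exact fun x hx => hle hx
  have step0 : ∀ k, (∀ x ∈ C k, od x ∈ C (k + 1)) → ∀ x ∈ C (k + 1), ev x ∈ C (k + 2) := by
    intro k hk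
    have hle : C (k + 1) ≤
        (C (k + 2)).comap ((LinearMap.inl ℂ V₀ V₁).comp (LinearMap.fst ℂ V₀ V₁)) := by
      refine lowerCentral_succ_le_of fun a ha b => ?_
      change ev (μ a b) ∈ C (k + 2)
      rw [h.ev_mul]
      exact add_mem (h.mul_mem_of_le (h.ev_mem ha) (h0 (ev b) rfl) (by omega))
        (mul_mem_lowerCentral_succ (hk a ha) _)
    exact fun x hx => hle hx
  induction k with
  | zero => exact ⟨fun x _ => h0 _ rfl, step1 0 fun x _ => h0 _ rfl⟩
  | succ k ih =>
    have := step0 _ ih.2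
    exact ⟨this, step1 _ this⟩

/-- If the even part is two-dimensional and the nilindex is at least six, then the even part is
not contained in the derived superalgebra. -/
theorem IsLeibniz.exists_even_generator (h : IsLeibniz μ) (hn : IsNilpotent μ)
    (hdim : finrank ℂ V₀ = 2) (h5 : C 5 ≠ ⊥) : ∃ x : V₀ × V₁, x.2 = 0 ∧ x ∉ C 1 := by
  by_contra! hcon
  have : FiniteDimensional ℂ V₀ := FiniteDimensional.of_finrank_pos (by omega)
  let E : ℕ → Submodule ℂ V₀ := fun k => (C k).comap (LinearMap.inl ℂ V₀ V₁)
  have hanti : ∀ k, E (k + 1) ≤ E k := fun k => Submodule.comap_mono (lowerCentral_succ_le k)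
  have hlt : ∀ k, C (2 * k + 1) ≠ ⊥ → E (2 * k + 2) < E (2 * k + 1) := by
    intro k hk
    refine lt_of_le_of_ne (hanti _) fun heq => hn.not_le_succ hk fun x hx => ?_
    rw [← ev_add_od x]
    refine add_mem ?_ ((h.parity_of_even_le hcon k).2 x hx)
    have : x.1 ∈ E (2 * k + 2) := by
      rw [heq]
      exact h.ev_mem hx
    exact this
  -- The quotients at k = 1, 3, 5 are nonzero and purely even: three drops, too many for a
  -- two-dimensional even part.
  have l0 := Submodule.finrank_lt_finrank_of_lt (hlt 0 (lowerCentral_ne_bot_of_le (by omega) h5))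
  have l1 := Submodule.finrank_lt_finrank_of_lt (hlt 1 (lowerCentral_ne_bot_of_le (by omega) h5))
  have l2 := Submodule.finrank_lt_finrank_of_lt (hlt 2 h5)
  have e0 := Submodule.finrank_mono (hanti 2)
  have e1 := Submodule.finrank_mono (hanti 4)
  have e2 := (E 1).finrank_le
  simp only [Nat.reduceMul, Nat.reduceAdd] at l0 l1 l2 e0 e1
  omega

/-- A nilpotent Leibniz superalgebra generated by one even element `X₀` and one odd element `Y₁`,
in which `X₁` spans the even part of the derived superalgebra and the nonzero quotients of
consecutive terms `Cᵏ(L)`, `1 ≤ k ≤ m`, are lines. -/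
structure IsAdapted (μ : Law V₀ V₁) (m : ℕ) (X₀ X₁ Y₁ : V₀ × V₁) : Prop where
  even₀ : X₀.2 = 0
  even₁ : X₁.2 = 0
  odd : Y₁.1 = 0
  ne_zero : X₁ ≠ 0
  mem_one : X₁ ∈ lowerCentral μ 1
  even_derived : ∀ x ∈ lowerCentral μ 1, x.2 = 0 → ∃ a : ℂ, x = a • X₁
  generate : ∀ x : V₀ × V₁, ∃ a b : ℂ, ∃ c ∈ lowerCentral μ 1, x = a • X₀ + b • Y₁ + c
  line : ∀ k, 1 ≤ k → ∀ z ∈ lowerCentral μ k, z ∉ lowerCentral μ (k + 1) →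
    ∀ x ∈ lowerCentral μ k, ∃ a : ℂ, ∃ c ∈ lowerCentral μ (k + 1), x = a • z + c
  strict : ∀ k ≤ m, ¬ lowerCentral μ k ≤ lowerCentral μ (k + 1)
  bot : lowerCentral μ (m + 1) = ⊥

theorem finrank_add_one_le_finrank_sup_span {W : Type} [AddCommGroup W] [Module ℂ W]
    [FiniteDimensional ℂ W] {A : Submodule ℂ W} {z : W} (hz : z ∉ A) :
    finrank ℂ A + 1 ≤ finrank ℂ ↥(A ⊔ Submodule.span ℂ {z}) := by
  refine Submodule.finrank_lt_finrank_of_lt (lt_of_le_of_ne le_sup_left fun heq => hz ?_)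
  rw [heq]
  exact Submodule.mem_sup_right (Submodule.mem_span_singleton_self z)

/-- A nilpotent Leibniz superalgebra of type `(2, m)`, `m ≥ 5`, of nilindex larger than `m` has
an adapted set of generators. -/
theorem IsLeibniz.exists_isAdapted (h : IsLeibniz μ) (hn : IsNilpotent μ) {m : ℕ} (hm : 5 ≤ m)
    (hdim₀ : finrank ℂ V₀ = 2) (hdim₁ : finrank ℂ V₁ = m) (hC : C m ≠ ⊥) :
    ∃ X₀ X₁ Y₁, IsAdapted μ m X₀ X₁ Y₁ := by
  have : FiniteDimensional ℂ V₀ := FiniteDimensional.of_finrank_pos (by omega)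
  have : FiniteDimensional ℂ V₁ := FiniteDimensional.of_finrank_pos (by omega)
  have : Nontrivial V₁ := nontrivial_of_finrank_pos (R := ℂ) (by omega)
  obtain ⟨X₀, hX₀, hX₀C⟩ :=
    h.exists_even_generator hn hdim₀ (lowerCentral_ne_bot_of_le hm hC)
  obtain ⟨Y₁, hY₁, hY₁C⟩ := h.exists_odd_generator hn
  have hnb : ∀ k ≤ m, C k ≠ ⊥ := fun k hk => lowerCentral_ne_bot_of_le hk hC
  have hdimV : finrank ℂ (V₀ × V₁) = m + 2 := by rw [finrank_prod]; omega
  have hdrop : ∀ k ≤ m, finrank ℂ (C (k + 1)) + 1 ≤ finrank ℂ (C k) := fun k hk =>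
    Submodule.finrank_lt_finrank_of_lt (hn.lt_succ (hnb k hk))
  set G := C 1 ⊔ Submodule.span ℂ {X₀} with hG
  have hYG : Y₁ ∉ G := by
    intro hY
    obtain ⟨c, hc, x, hx, hcx⟩ := Submodule.mem_sup.1 hY
    obtain ⟨a, rfl⟩ := Submodule.mem_span_singleton.1 hx
    refine hY₁C ?_
    rw [← od_of_odd hY₁]
    have : od Y₁ = od c := by simp [← hcx, hX₀]
    rw [this]
    exact h.od_mem hc
  have f1 := finrank_add_one_le_finrank_sup_span hX₀C
  have f2 := finrank_add_one_le_finrank_sup_span hYG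
  have f3 := (G ⊔ Submodule.span ℂ {Y₁}).finrank_le
  rw [hdimV] at f3
  rw [← hG] at f1
  -- Counting drops upwards from Cᵐ⁺¹ gives dim C¹ ≥ m, while the two generators give dim C¹ ≤ m. No
  -- slack remains, so every drop is exactly one.
  have hlow : ∀ j ≤ m, j + finrank ℂ (C (m + 1)) + 1 ≤ finrank ℂ (C (m - j)) := by
    intro j hj
    induction j with
    | zero => simpa using hdrop m le_rfl
    | succ j ih =>
      have := ih (by omega)
      have h2 := hdrop (m - (j + 1)) (by omega)
      rw [show m - (j + 1) + 1 = m - j by omega] at h2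
      omega
  have hone : finrank ℂ (C 1) = m := by
    have := hlow (m - 1) (by omega)
    rw [show m - (m - 1) = 1 by omega] at this
    omega
  have hlast : finrank ℂ (C (m + 1)) = 0 := by
    have := hlow (m - 1) (by omega)
    rw [show m - (m - 1) = 1 by omega] at this
    omega
  have hbot : C (m + 1) = ⊥ := Submodule.finrank_eq_zero.1 hlast
  have hup : ∀ j ≤ m, finrank ℂ (C (1 + j)) + j ≤ m := by
    intro j hj
    induction j with
    | zero => simp [hone]
    | succ j ih =>
      have := ih (by omega)
      have h2 := hdrop (1 + j) (by omega)
      rw [show 1 + (j + 1) = 1 + j + 1 by omega]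
      omega
  have hline : ∀ k, 1 ≤ k → finrank ℂ (C k) ≤ finrank ℂ (C (k + 1)) + 1 := by
    intro k hk
    by_cases hkm : k ≤ m
    · have h1 := hup (k - 1) (by omega)
      rw [show 1 + (k - 1) = k by omega] at h1
      rcases Nat.eq_or_lt_of_le hkm with rfl | hlt
      · omega
      · have h2 := hlow (m - (k + 1)) (by omega)
        rw [show m - (m - (k + 1)) = k + 1 by omega] at h2
        omega
    · have : C k = ⊥ := le_bot_iff.1 (hbot ▸ lowerCentral_antitone (by omega))
      rw [this]
      simp
  have htop : G ⊔ Submodule.span ℂ {Y₁} = ⊤ := by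
    apply Submodule.eq_top_of_finrank_eq
    omega
  have hgen : ∀ x : V₀ × V₁, ∃ a b : ℂ, ∃ c ∈ C 1, x = a • X₀ + b • Y₁ + c := by
    intro x
    have hx : x ∈ G ⊔ Submodule.span ℂ {Y₁} := htop ▸ trivial
    obtain ⟨g, hg, y, hy, rfl⟩ := Submodule.mem_sup.1 hx
    obtain ⟨c, hc, z, hz, rfl⟩ := Submodule.mem_sup.1 hg
    obtain ⟨b, rfl⟩ := Submodule.mem_span_singleton.1 hy
    obtain ⟨a, rfl⟩ := Submodule.mem_span_singleton.1 hz
    exact ⟨a, b, c, hc, by abel⟩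
  -- The even part of C¹ is a line: X₀ lies outside it and spans L₀ together with it.
  let E : Submodule ℂ V₀ := (C 1).comap (LinearMap.inl ℂ V₀ V₁)
  have hE1 : finrank ℂ E = 1 := by
    have hX : X₀.1 ∉ E := fun hmem => hX₀C (by rw [← ev_of_even hX₀]; exact hmem)
    have g1 := finrank_add_one_le_finrank_sup_span hX
    have g2 := (E ⊔ Submodule.span ℂ {X₀.1}).finrank_le
    have g3 : E ⊔ Submodule.span ℂ {X₀.1} = ⊤ := by
      refine top_unique fun v _ => ?_
      obtain ⟨a, b, c, hc, hv⟩ := hgen (v, 0)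
      have hv1 : v = a • X₀.1 + c.1 := by simpa [hY₁] using congrArg Prod.fst hv
      rw [hv1]
      exact add_mem (Submodule.mem_sup_right (Submodule.smul_mem _ _
        (Submodule.mem_span_singleton_self _))) (Submodule.mem_sup_left (h.ev_mem hc))
    have g4 := Submodule.finrank_add_le_finrank_add_finrank E (Submodule.span ℂ {X₀.1})
    rw [g3, finrank_top] at g4
    have g5 := finrank_span_singleton (K := ℂ) (v := X₀.1) fun h0 => hX (h0 ▸ E.zero_mem)
    omega
  obtain ⟨⟨e, he⟩, hne, hspan⟩ := finrank_eq_one_iff'.1 hE1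
  refine ⟨X₀, (e, 0), Y₁, hX₀, rfl, hY₁, ?_, he, ?_, hgen, ?_,
    fun k hk => hn.not_le_succ (hnb k hk), hbot⟩
  · intro h0
    exact hne (Subtype.ext (congrArg Prod.fst h0))
  · intro x hx hx2
    have hxE : x.1 ∈ E := h.ev_mem hx
    obtain ⟨a, ha⟩ := hspan ⟨x.1, hxE⟩
    have := congrArg Subtype.val ha
    exact ⟨a, Prod.ext this.symm (by simp [hx2])⟩
  · intro k hk z hz hz' x hx
    have g1 := finrank_add_one_le_finrank_sup_span hz'
    have hle : C (k + 1) ⊔ Submodule.span ℂ {z} ≤ C k :=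
      sup_le (lowerCentral_succ_le k) ((Submodule.span_singleton_le_iff_mem _ _).2 hz)
    have heq := Submodule.eq_of_le_of_finrank_le hle ((hline k hk).trans g1)
    rw [← heq] at hx
    obtain ⟨c, hc, y, hy, rfl⟩ := Submodule.mem_sup.1 hx
    obtain ⟨a, rfl⟩ := Submodule.mem_span_singleton.1 hy
    exact ⟨a, c, hc, add_comm _ _⟩

end UpperBound

/-! ### Consequences of an adapted generating set. -/

section Adapted

variable {V₀ V₁ : Type} [AddCommGroup V₀] [Module ℂ V₀] [AddCommGroup V₁] [Module ℂ V₁]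
variable {μ : Law V₀ V₁} {m : ℕ} {X₀ X₁ Y₁ : V₀ × V₁}

local notation "C" => lowerCentral μ

namespace IsAdapted

theorem succ_generate (A : IsAdapted μ m X₀ X₁ Y₁) (h : IsLeibniz μ) {k : ℕ} (hk : 1 ≤ k)
    {z : V₀ × V₁} (hz : z ∈ C k) (hz' : z ∉ C (k + 1)) {x : V₀ × V₁} (hx : x ∈ C (k + 1)) :
    ∃ a b : ℂ, ∃ c ∈ C (k + 2), x = a • μ z X₀ + b • μ z Y₁ + c := by
  have hle : C (k + 1) ≤ Submodule.span ℂ {μ z X₀, μ z Y₁} ⊔ C (k + 2) := by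
    refine lowerCentral_succ_le_of fun u hu v => ?_
    obtain ⟨t, d, hd, rfl⟩ := A.line k hk z hz hz' u hu
    obtain ⟨a, b, c, hc, rfl⟩ := A.generate v
    have hmain : a • μ z X₀ + b • μ z Y₁ ∈ Submodule.span ℂ {μ z X₀, μ z Y₁} :=
      Submodule.mem_span_pair.2 ⟨a, b, rfl⟩
    rw [LinearMap.map_add₂]
    refine add_mem ?_ (Submodule.mem_sup_right (mul_mem_lowerCentral_succ hd _))
    rw [LinearMap.map_smul₂]
    refine Submodule.smul_mem _ _ ?_
    rw [map_add, map_add, map_smul, map_smul]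
    exact add_mem (Submodule.mem_sup_left hmain)
      (Submodule.mem_sup_right (h.mul_mem_of_le hz hc (by omega)))
  obtain ⟨y, hy, c, hc, rfl⟩ := Submodule.mem_sup.1 (hle hx)
  obtain ⟨a, b, rfl⟩ := Submodule.mem_span_pair.1 hy
  exact ⟨a, b, c, hc, rfl⟩

/-- The two products with the generators span Cᵏ⁺¹ modulo Cᵏ⁺², and this quotient is nonzero. -/
theorem mul_notMem (A : IsAdapted μ m X₀ X₁ Y₁) (h : IsLeibniz μ) {k : ℕ} (hk : 1 ≤ k)
    (hkm : k + 1 ≤ m) {z : V₀ × V₁} (hz : z ∈ C k) (hz' : z ∉ C (k + 1)) :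
    μ z X₀ ∉ C (k + 2) ∨ μ z Y₁ ∉ C (k + 2) := by
  by_contra! hcon
  refine A.strict (k + 1) hkm fun x hx => ?_
  obtain ⟨a, b, c, hc, rfl⟩ := A.succ_generate h hk hz hz' hx
  exact add_mem (add_mem (Submodule.smul_mem _ _ hcon.1) (Submodule.smul_mem _ _ hcon.2)) hc

theorem eq_zero_of_even (A : IsAdapted μ m X₀ X₁ Y₁) {p : ℕ} (hp : X₁ ∉ C (p + 1))
    {x : V₀ × V₁} (hx : x ∈ C (p + 1)) (hx2 : x.2 = 0) : x = 0 := by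
  obtain ⟨a, rfl⟩ := A.even_derived x (lowerCentral_antitone (by omega) hx) hx2
  rcases eq_or_ne a 0 with rfl | ha
  · simp
  · exact absurd ((Submodule.smul_mem_iff _ ha).1 hx) hp

/-- When the even vector X₁ spans the line Cᵏ/Cᵏ⁺¹, there is no room in it for odd elements. -/
theorem mem_succ_of_line (A : IsAdapted μ m X₀ X₁ Y₁) {k : ℕ} (hk : 1 ≤ k) (hX : X₁ ∈ C k)
    (hX' : X₁ ∉ C (k + 1)) {x : V₀ × V₁} (hx : x ∈ C k) (hx1 : x.1 = 0) (h : IsLeibniz μ) :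
    x ∈ C (k + 1) := by
  obtain ⟨a, c, hc, rfl⟩ := A.line k hk X₁ hX hX' x hx
  have : od (a • X₁ + c) = od c := by simp [A.even₁]
  rw [← od_of_odd hx1, this]
  exact h.od_mem hc

theorem mul_X₁_Y₁_notMem (A : IsAdapted μ m X₀ X₁ Y₁) (h : IsLeibniz μ) {p : ℕ} (hp : 1 ≤ p)
    (hpm : p < m) (hX : X₁ ∈ C p) (hX' : X₁ ∉ C (p + 1)) :
    μ X₁ X₀ = 0 ∧ μ X₁ Y₁ ∉ C (p + 2) := by
  have h0 : μ X₁ X₀ = 0 := A.eq_zero_of_even hX' (mul_mem_lowerCentral_succ hX _)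
    (h.even_even A.even₁ A.even₀)
  refine ⟨h0, ?_⟩
  rcases A.mul_notMem h hp hpm hX hX' with hc | hc
  · exact absurd (h0 ▸ Submodule.zero_mem _) hc
  · exact hc

/-- Otherwise X₁ spans C¹/C² and u = [X₁, Y₁] spans C²/C³. Then [u, Y₁] is even in C², hence zero,
and [u, X₀] = [X₁, [Y₁, X₀]] lies in C⁴ because [Y₁, X₀] is odd and so in C². Nothing is left to
generate C³/C⁴. -/
theorem mem_two (A : IsAdapted μ m X₀ X₁ Y₁) (h : IsLeibniz μ) (hm : 3 ≤ m) : X₁ ∈ C 2 := by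
  by_contra hX
  obtain ⟨h0, hu⟩ := A.mul_X₁_Y₁_notMem h le_rfl (by omega) A.mem_one hX
  have hu2 : μ X₁ Y₁ ∈ C 2 := mul_mem_lowerCentral_succ A.mem_one _
  rcases A.mul_notMem h (by omega) hm hu2 hu with hc | hc
  · apply hc
    have hid := h.identity_odd_even X₁ A.odd A.even₀
    rw [h0, map_zero, LinearMap.zero_apply, sub_zero] at hid
    rw [← hid]
    have hY : μ Y₁ X₀ ∈ C 2 := A.mem_succ_of_line le_rfl A.mem_one hX
      (mul_mem_lowerCentral_succ (k := 0) trivial _) (h.odd_even A.odd A.even₀) h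
    exact h.mul_mem_lowerCentral 2 1 A.mem_one hY
  · apply hc
    rw [A.eq_zero_of_even hX (lowerCentral_antitone (by omega) (mul_mem_lowerCentral_succ hu2 Y₁))
      (h.odd_odd (h.even_odd A.even₁ A.odd) A.odd)]
    exact Submodule.zero_mem _

/-- The even element of the derived superalgebra lies in the last nonzero term of the descending
central sequence. -/
theorem mem_last (A : IsAdapted μ m X₀ X₁ Y₁) (h : IsLeibniz μ) (hm : 3 ≤ m) : X₁ ∈ C m := by
  suffices hall : ∀ p, 2 ≤ p → p ≤ m → X₁ ∈ C p from hall m (by omega) le_rfl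
  intro p hp
  induction p, hp using Nat.le_induction with
  | base => exact fun _ => A.mem_two h hm
  | succ p hp ih =>
    intro hpm
    have hX := ih (by omega)
    by_contra hX'
    obtain ⟨h0, hu⟩ := A.mul_X₁_Y₁_notMem h (by omega) (by omega) hX hX'
    apply hu
    obtain ⟨q, rfl⟩ : ∃ q, p = q + 1 := ⟨p - 1, by omega⟩
    -- If X₁ stops at level q + 1, it is a multiple of [z, Y₁] for an odd z one level higher, and
    -- 2[[z, Y₁], Y₁] = [z, [Y₁, Y₁]].
    obtain ⟨z, hz, hz'⟩ := SetLike.not_le_iff_exists.1 (A.strict q (by omega))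
    have hev : ev z ∈ C (q + 1) := by
      obtain ⟨a, ha⟩ := A.even_derived (ev z)
        (lowerCentral_antitone (by omega) (h.ev_mem hz)) rfl
      rw [ha]
      exact Submodule.smul_mem _ _ hX
    have hod : od z ∉ C (q + 1) := fun hod => hz' (by rw [← ev_add_od z]; exact add_mem hev hod)
    obtain ⟨a, b, c, hc, hx⟩ := A.succ_generate h (by omega) (h.od_mem hz) hod hX
    have hc0 : ev c = 0 := A.eq_zero_of_even hX' (h.ev_mem hc) rfl
    have hYY : (μ (od z) Y₁).2 = 0 := h.odd_odd rfl A.odd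
    have hX₁ : X₁ = b • μ (od z) Y₁ := by
      have h1 : (μ (od z) X₀).1 = 0 := h.odd_even rfl A.even₀
      have h2 : c.1 = 0 := congrArg Prod.fst hc0
      ext1
      · simpa [h1, h2] using congrArg Prod.fst hx
      · simp [hYY, A.even₁]
    have hid := h.identity_odd_odd (od z) A.odd A.odd
    rw [← two_smul ℂ] at hid
    -- [Y₁, Y₁] is a multiple of X₁, hence in C^{q+1}, and the product lands in C^{2q+2} ⊆ C^{q+3}
    -- since q ≥ 1.
    have hmem : μ (od z) (μ Y₁ Y₁) ∈ C (q + 1 + 2) := by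
      have hY1 : μ Y₁ Y₁ ∈ C 1 := mul_mem_lowerCentral_succ (k := 0) trivial _
      obtain ⟨t, ht⟩ := A.even_derived _ hY1 (h.odd_odd A.odd A.odd)
      have : μ Y₁ Y₁ ∈ C (q + 1) := ht ▸ Submodule.smul_mem _ _ hX
      exact h.mul_mem_of_le (h.od_mem hz) this (by omega)
    rw [hid, Submodule.smul_mem_iff _ two_ne_zero] at hmem
    rw [hX₁, map_smul, LinearMap.smul_apply]
    exact Submodule.smul_mem _ _ hmem

theorem even_mem_last (A : IsAdapted μ m X₀ X₁ Y₁) (h : IsLeibniz μ) (hm : 3 ≤ m)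
    {x : V₀ × V₁} (hx : x ∈ C 1) (hx2 : x.2 = 0) : x ∈ C m := by
  obtain ⟨a, rfl⟩ := A.even_derived x hx hx2
  exact Submodule.smul_mem _ _ (A.mem_last h hm)

theorem eq_zero_of_mem (A : IsAdapted μ m X₀ X₁ Y₁) {k : ℕ} (hk : m + 1 ≤ k) {x : V₀ × V₁}
    (hx : x ∈ C k) : x = 0 := by
  have := lowerCentral_antitone hk hx
  rwa [A.bot, Submodule.mem_bot] at this

/-- Such x lies in Cᵐ, and Cᵐ⁺¹ = 0. This removes one term from each Leibniz identity used below. -/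
theorem mul_even_eq_zero (A : IsAdapted μ m X₀ X₁ Y₁) (h : IsLeibniz μ) (hm : 3 ≤ m)
    {x : V₀ × V₁} (hx : x ∈ C 1) (hx2 : x.2 = 0) (y : V₀ × V₁) : μ x y = 0 ∧ μ y x = 0 :=
  ⟨A.eq_zero_of_mem le_rfl (mul_mem_lowerCentral_succ (A.even_mem_last h hm hx hx2) y),
    A.eq_zero_of_mem le_rfl
      (h.mul_mem_of_le (i := 0) trivial (A.even_mem_last h hm hx hx2) (by omega))⟩

theorem mul_mem_one (x y : V₀ × V₁) : μ x y ∈ C 1 :=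
  mul_mem_lowerCentral_succ (k := 0) trivial y

theorem left_right_comm (A : IsAdapted μ m X₀ X₁ Y₁) (h : IsLeibniz μ) (hm : 3 ≤ m)
    {y : V₀ × V₁} (hy : y.1 = 0) : μ X₀ (μ y X₀) = μ (μ X₀ y) X₀ := by
  rw [h.identity_odd_even X₀ hy A.even₀,
    (A.mul_even_eq_zero h hm (mul_mem_one X₀ X₀) (h.even_even A.even₀ A.even₀) y).1, sub_zero]

/-- Right multiplication by `X₀` is skew with respect to the product of odd elements. -/
theorem right_skew (A : IsAdapted μ m X₀ X₁ Y₁) (h : IsLeibniz μ) (hm : 3 ≤ m)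
    {x y : V₀ × V₁} (hx : x.1 = 0) (hy : y.1 = 0) : μ x (μ y X₀) = -μ (μ x X₀) y := by
  rw [h.identity_odd_even x hy A.even₀,
    (A.mul_even_eq_zero h hm (mul_mem_one x y) (h.odd_odd hx hy) X₀).1, zero_sub]

theorem left_adjoint (A : IsAdapted μ m X₀ X₁ Y₁) (h : IsLeibniz μ) (hm : 3 ≤ m)
    {x y : V₀ × V₁} (hx : x.1 = 0) (hy : y.1 = 0) : μ x (μ X₀ y) = μ (μ x X₀) y := by
  rw [h.identity_even_odd x A.even₀ hy,
    (A.mul_even_eq_zero h hm (mul_mem_one x y) (h.odd_odd hx hy) X₀).1, sub_zero]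

theorem left_exchange (A : IsAdapted μ m X₀ X₁ Y₁) (h : IsLeibniz μ) (hm : 3 ≤ m)
    {x y : V₀ × V₁} (hx : x.1 = 0) (hy : y.1 = 0) : μ (μ X₀ x) y + μ (μ X₀ y) x = 0 := by
  rw [← h.identity_odd_odd X₀ hx hy,
    (A.mul_even_eq_zero h hm (mul_mem_one x y) (h.odd_odd hx hy) X₀).2]

/-- The product with Y₁ is even, so it falls into Cᵐ and cannot generate the next quotient; X₀ must
do so. -/
theorem mul_X₀_notMem (A : IsAdapted μ m X₀ X₁ Y₁) (h : IsLeibniz μ) {k : ℕ} (hk : 1 ≤ k)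
    (hkm : k + 2 ≤ m) {z : V₀ × V₁} (hz : z ∈ C k) (hz1 : z.1 = 0) (hz' : z ∉ C (k + 1)) :
    μ z X₀ ∉ C (k + 2) := by
  rcases A.mul_notMem h hk (by omega) hz hz' with hc | hc
  · exact hc
  · exact absurd (lowerCentral_antitone hkm
      (A.even_mem_last h (by omega) (mul_mem_one z Y₁) (h.odd_odd hz1 A.odd))) hc

/-- If [Y₁, X₀] were in C², then [X₀, Y₁] would have to span C¹/C², and [[X₀, Y₁], X₀] would be
outside C³. But it equals [X₀, [Y₁, X₀]], which is in C³. -/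
theorem mul_Y₁_X₀_notMem (A : IsAdapted μ m X₀ X₁ Y₁) (h : IsLeibniz μ) (hm : 3 ≤ m) :
    μ Y₁ X₀ ∉ C 2 := by
  intro hR
  have heven : ∀ x y : V₀ × V₁, (μ x y).2 = 0 → μ x y ∈ C 2 := fun x y hxy =>
    lowerCentral_antitone (by omega) (A.even_mem_last h hm (mul_mem_one x y) hxy)
  have hL : μ X₀ Y₁ ∉ C 2 := by
    intro hL
    refine A.strict 1 (by omega) (lowerCentral_succ_le_of fun u _ v => ?_)
    obtain ⟨a, b, c, hc, rfl⟩ := A.generate u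
    obtain ⟨a', b', c', hc', rfl⟩ := A.generate v
    simp only [map_add, LinearMap.add_apply, map_smul, LinearMap.smul_apply]
    have e1 := heven X₀ X₀ (h.even_even A.even₀ A.even₀)
    have e2 := heven Y₁ Y₁ (h.odd_odd A.odd A.odd)
    have e3 : ∀ w, μ c w ∈ C 2 := fun w => mul_mem_lowerCentral_succ hc w
    have e4 : ∀ w, μ w c' ∈ C 2 := fun w => h.mul_mem_of_le (i := 0) trivial hc' (by omega)
    have s : ∀ (t : ℂ) {w : V₀ × V₁}, w ∈ C 2 → t • w ∈ C 2 := fun t _ hw =>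
      Submodule.smul_mem _ t hw
    exact add_mem (add_mem (s _ (add_mem (add_mem (s _ e1) (s _ hR)) (e3 _)))
      (s _ (add_mem (add_mem (s _ hL) (s _ e2)) (e3 _))))
      (add_mem (add_mem (s _ (e4 _)) (s _ (e4 _))) (e4 _))
  refine A.mul_X₀_notMem h le_rfl hm (mul_mem_one _ _) (h.even_odd A.even₀ A.odd) hL ?_
  rw [← A.left_right_comm h hm A.odd]
  exact h.mul_mem_of_le (i := 0) trivial hR (by omega)

/-- The elements obtained from `y` by repeated right multiplication by `X₀`. -/
def rightPow (μ : Law V₀ V₁) (x y : V₀ × V₁) : ℕ → V₀ × V₁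
  | 0 => y
  | k + 1 => μ (rightPow μ x y k) x

theorem rightPow_odd (h : IsLeibniz μ) {x y : V₀ × V₁} (hx : x.2 = 0) (hy : y.1 = 0) (k : ℕ) :
    (rightPow μ x y k).1 = 0 := by
  induction k with
  | zero => exact hy
  | succ k ih => exact h.odd_even ih hx

theorem rightPow_mem (x : V₀ × V₁) {y : V₀ × V₁} {j : ℕ} (hy : y ∈ C j) (k : ℕ) :
    rightPow μ x y k ∈ C (j + k) := by
  induction k with
  | zero => exact hy
  | succ k ih => exact mul_mem_lowerCentral_succ ih x

theorem rightPow_succ (x y : V₀ × V₁) (k : ℕ) :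
    rightPow μ x y (k + 1) = rightPow μ x (μ y x) k := by
  induction k with
  | zero => rfl
  | succ k ih => exact congrArg (fun w => μ w x) ih

theorem rightPow_add (x y z : V₀ × V₁) (k : ℕ) :
    rightPow μ x (y + z) k = rightPow μ x y k + rightPow μ x z k := by
  induction k with
  | zero => rfl
  | succ k ih => simp [rightPow, ih]

theorem rightPow_smul (x y : V₀ × V₁) (a : ℂ) (k : ℕ) :
    rightPow μ x (a • y) k = a • rightPow μ x y k := by
  induction k with
  | zero => rfl
  | succ k ih => simp [rightPow, ih]

theorem left_rightPow (A : IsAdapted μ m X₀ X₁ Y₁) (h : IsLeibniz μ) (hm : 3 ≤ m)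
    {y : V₀ × V₁} (hy : y.1 = 0) (k : ℕ) :
    μ X₀ (rightPow μ X₀ y k) = rightPow μ X₀ (μ X₀ y) k := by
  induction k with
  | zero => rfl
  | succ k ih =>
    rw [rightPow, A.left_right_comm h hm (rightPow_odd h A.even₀ hy k), ih]
    rfl

theorem rightPow_skew (A : IsAdapted μ m X₀ X₁ Y₁) (h : IsLeibniz μ) (hm : 3 ≤ m)
    (k : ℕ) : ∀ {x y : V₀ × V₁}, x.1 = 0 → y.1 = 0 →
      μ x (rightPow μ X₀ y k) = (-1 : ℂ) ^ k • μ (rightPow μ X₀ x k) y := by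
  induction k with
  | zero => intro x y _ _; simp [rightPow]
  | succ k ih =>
    intro x y hx hy
    rw [rightPow, A.right_skew h hm hx (rightPow_odd h A.even₀ hy k),
      ih (h.odd_even hx A.even₀) hy, ← rightPow_succ, pow_succ]
    simp

theorem rightPow_notMem (A : IsAdapted μ m X₀ X₁ Y₁) (h : IsLeibniz μ) (hm : 3 ≤ m) {k : ℕ}
    (hk : k + 2 ≤ m) : rightPow μ X₀ Y₁ (k + 1) ∉ C (k + 2) := by
  induction k with
  | zero => exact A.mul_Y₁_X₀_notMem h hm
  | succ k ih =>
    have hmem : rightPow μ X₀ Y₁ (k + 1) ∈ C (k + 1) := by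
      simpa using rightPow_mem (μ := μ) (j := 0) X₀ (y := Y₁) trivial (k + 1)
    exact A.mul_X₀_notMem h (by omega) (by omega) hmem (rightPow_odd h A.even₀ A.odd _)
      (ih (by omega))

/-- An adapted set of generators forces the dimension of the odd part to be odd. -/
theorem odd_dim (A : IsAdapted μ m X₀ X₁ Y₁) (h : IsLeibniz μ) (hm : 3 ≤ m) : Odd m := by
  obtain ⟨n, rfl⟩ : ∃ n, m = n + 2 := ⟨m - 2, by omega⟩
  by_contra hodd
  have hn : Even n := by
    rw [Nat.not_odd_iff_even] at hodd
    exact (Nat.even_add.1 hodd).2 even_two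
  set e := rightPow μ X₀ Y₁ n with he
  have heC : e ∈ C n := by
    simpa using rightPow_mem (μ := μ) (j := 0) X₀ (y := Y₁) trivial n
  have he1 : e.1 = 0 := rightPow_odd h A.even₀ A.odd n
  have hmem : μ e X₀ ∈ C (n + 1) := mul_mem_lowerCentral_succ heC _
  have hne : μ e X₀ ∉ C (n + 2) := A.rightPow_notMem h hm le_rfl
  have hne1 : (μ e X₀).1 = 0 := h.odd_even he1 A.even₀
  -- The last line Cᵐ is spanned by X₁, so the odd product with X₀ vanishes there and the product
  -- with Y₁ must produce it.
  have hβ : μ (μ e X₀) Y₁ ≠ 0 := by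
    have hzero : μ (μ e X₀) X₀ = 0 := by
      refine A.eq_zero_of_mem le_rfl (A.mem_succ_of_line (by omega) (A.mem_last h hm) ?_
        (mul_mem_lowerCentral_succ hmem _) (h.odd_even hne1 A.even₀) h)
      exact fun hX => A.ne_zero (A.eq_zero_of_mem le_rfl hX)
    intro hcon
    rcases A.mul_notMem h (by omega) le_rfl hmem hne with hc | hc
    · exact hc (hzero ▸ Submodule.zero_mem _)
    · exact hc (hcon ▸ Submodule.zero_mem _)
  obtain ⟨c, r, hr, hL⟩ := A.line 1 le_rfl (μ Y₁ X₀) (mul_mem_one _ _)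
    (A.mul_Y₁_X₀_notMem h hm) (μ X₀ Y₁) (mul_mem_one _ _)
  have hskew : μ e (μ Y₁ X₀) = -μ (μ e X₀) Y₁ := A.right_skew h hm he1 A.odd
  have her : μ e r = 0 := A.eq_zero_of_mem le_rfl (h.mul_mem_of_le heC hr (by omega))
  have hre : μ r e = 0 := A.eq_zero_of_mem le_rfl (h.mul_mem_of_le hr heC (by omega))
  -- With β = [[e, X₀], Y₁], adjointness gives [e, [X₀, Y₁]] = β, whereas skewness gives [e, [Y₁,
  -- X₀]] = -β.
  have hc : c = -1 := by
    have := A.left_adjoint h hm he1 A.odd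
    rw [hL, map_add, map_smul, her, hskew, add_zero, smul_neg, ← neg_smul] at this
    have h1 : (-c - 1) • μ (μ e X₀) Y₁ = 0 := by rw [sub_smul, this, one_smul, sub_self]
    rcases smul_eq_zero.1 h1 with h2 | h2
    · linear_combination -h2
    · exact absurd h2 hβ
  have hsymm : μ (μ Y₁ X₀) e = μ (μ e X₀) Y₁ := by
    rw [he, A.rightPow_skew h hm n (h.odd_even A.odd A.even₀) A.odd, hn.neg_one_pow, one_smul,
      ← rightPow_succ]
    rfl
  have hrY : μ (rightPow μ X₀ r n) Y₁ = 0 := A.eq_zero_of_mem (by omega)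
    (mul_mem_lowerCentral_succ (rightPow_mem X₀ hr n) Y₁)
  -- Both summands equal cβ: the first since [X₀, e] = Rⁿ[X₀, Y₁], the second since moving Rⁿ across
  -- costs (-1)ⁿ = 1. For odd n they would cancel.
  have hfin := A.left_exchange h hm he1 A.odd
  rw [he, A.left_rightPow h hm A.odd, ← he, hL, rightPow_add, rightPow_smul, ← rightPow_succ] at hfin
  simp only [map_add, map_smul, LinearMap.add_apply, LinearMap.smul_apply, hrY, hre, hsymm,
    hc] at hfin
  have h2 : (-2 : ℂ) • μ (μ e X₀) Y₁ = 0 := by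
    rw [← hfin]
    change _ = (-1 : ℂ) • μ (μ e X₀) Y₁ + 0 + _
    module
  exact hβ ((smul_eq_zero.1 h2).resolve_left (by norm_num))

end IsAdapted

theorem IsLeibniz.lowerCentral_succ_eq_bot (h : IsLeibniz μ) (hn : IsNilpotent μ) (hm : 5 ≤ m)
    (hdim₀ : finrank ℂ V₀ = 2) (hdim₁ : finrank ℂ V₁ = m) : C (m + 1) = ⊥ := by
  by_contra hC
  obtain ⟨_, _, _, A⟩ := h.exists_isAdapted hn hm hdim₀ hdim₁
    (lowerCentral_ne_bot_of_le (by omega) hC)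
  exact hC A.bot

theorem IsLeibniz.lowerCentral_eq_bot_of_even (h : IsLeibniz μ) (hn : IsNilpotent μ) (hm : 5 ≤ m)
    (hdim₀ : finrank ℂ V₀ = 2) (hdim₁ : finrank ℂ V₁ = m) (hev : Even m) : C m = ⊥ := by
  by_contra hC
  obtain ⟨_, _, _, A⟩ := h.exists_isAdapted hn hm hdim₀ hdim₁ hC
  exact Nat.not_odd_iff_even.2 hev (A.odd_dim h (by omega))

end Adapted

/-! ### Surjective homomorphisms and an obstruction to zero-filiformity. -/

section Homomorphisms

variable {V₀ V₁ W₀ W₁ : Type} [AddCommGroup V₀] [Module ℂ V₀] [AddCommGroup V₁] [Module ℂ V₁]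
  [AddCommGroup W₀] [Module ℂ W₀] [AddCommGroup W₁] [Module ℂ W₁]
variable {μ : Law V₀ V₁} {ν : Law W₀ W₁}

/-- A surjective homomorphism maps the descending central sequence onto the descending central
sequence. -/
theorem map_lowerCentral {F : (V₀ × V₁) →ₗ[ℂ] (W₀ × W₁)} (hF : Function.Surjective F)
    (hmul : ∀ x y, F (μ x y) = ν (F x) (F y)) (k : ℕ) :
    (lowerCentral μ k).map F = lowerCentral ν k := by
  induction k with
  | zero => exact (Submodule.map_top F).trans (LinearMap.range_eq_top.2 hF)
  | succ k ih =>
    apply le_antisymm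
    · rw [Submodule.map_le_iff_le_comap]
      refine lowerCentral_succ_le_of fun x hx y => ?_
      rw [Submodule.mem_comap, hmul]
      exact mul_mem_lowerCentral_succ (ih ▸ Submodule.mem_map_of_mem hx) _
    · refine lowerCentral_succ_le_of fun x hx y => ?_
      rw [← ih] at hx
      obtain ⟨x, hx, rfl⟩ := hx
      obtain ⟨y, rfl⟩ := hF y
      rw [← hmul]
      exact Submodule.mem_map_of_mem (mul_mem_lowerCentral_succ hx y)

/-- If products of even elements vanish, then the sequence `Cᵏ(L₀)` vanishes from `k = 1` on. -/
theorem not_hasSNilindex_of_even_mul_eq_zero {p q : ℕ} (hp : 2 ≤ p)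
    (h : ∀ x y : V₀ × V₁, x.2 = 0 → y.2 = 0 → μ x y = 0) : ¬ HasSNilindex μ p q := by
  intro hs
  have h1 : partCentral μ 0 1 = ⊥ :=
    le_bot_iff.1 (Submodule.map₂_le.2 fun x hx y hy =>
      (Submodule.mem_bot ℂ).2 (h x y (mem_part_zero.1 hx) (mem_part_zero.1 hy)))
  have := hs.1.2 h1
  omega

end Homomorphisms

/-! ### The superalgebras attaining the bound. -/

section Model

theorem shift_apply (m : ℕ) (u : Fin m → ℂ) (k : Fin m) :
    shift m u k = ∑ i : Fin m, if (i : ℕ) + 1 = k then u i else 0 := rfl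

theorem shift_single (m k : ℕ) (hk : k + 1 < m) :
    shift m (Pi.single ⟨k, by omega⟩ 1) = Pi.single ⟨k + 1, hk⟩ 1 := by
  ext j
  rw [shift_apply, Finset.sum_eq_single ⟨k, by omega⟩]
  · by_cases hj : k + 1 = (j : ℕ)
    · have : j = ⟨k + 1, hk⟩ := Fin.ext hj.symm
      simp [this]
    · have : j ≠ ⟨k + 1, hk⟩ := fun h => hj (by rw [h])
      simp [hj, this]
  · intro i _ hi
    simp [Pi.single_eq_of_ne hi]
  · simp

/-- The signed bilinear pairing `(u, v) ↦ ∑ (-1)ⁱ uᵢ v_{m-1-i}`. -/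
def pairing (m : ℕ) (u v : Fin m → ℂ) : ℂ := ∑ i : Fin m, (-1) ^ (i : ℕ) * u i * v i.rev

/-- Reversal replaces i by m - 1 - i, which has the same parity as i when m is odd. -/
theorem pairing_comm {m : ℕ} (hm : Odd m) (u v : Fin m → ℂ) : pairing m u v = pairing m v u := by
  unfold pairing
  rw [← Equiv.sum_comp Fin.revPerm]
  refine Finset.sum_congr rfl fun i _ => ?_
  have hsign : (-1 : ℂ) ^ (i.rev : ℕ) = (-1) ^ (i : ℕ) := by
    have : Even ((i.rev : ℕ) + i) := by
      rw [Fin.val_rev, show m - ((i : ℕ) + 1) + i = m - 1 by omega]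
      exact Nat.Odd.sub_odd hm odd_one
    rw [← mul_right_inj' (pow_ne_zero (i : ℕ) (by norm_num : (-1 : ℂ) ≠ 0)), ← pow_add, ← pow_add,
      add_comm, this.neg_one_pow, (Even.add_self (i : ℕ)).neg_one_pow]
  simp only [Fin.revPerm_apply, Fin.rev_rev, hsign]
  ring

/-- Both sides sum the same products over adjacent indices i = j + 1, with signs (-1)ⁱ and (-1)ʲ. -/
theorem pairing_shift (m : ℕ) (u v : Fin m → ℂ) :
    pairing m (shift m u) v = -pairing m u (shift m v) := by
  have h1 : pairing m (shift m u) v =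
      ∑ j : Fin m, ∑ i : Fin m, if (j : ℕ) + 1 = i then (-1) ^ (i : ℕ) * u j * v i.rev else 0 := by
    unfold pairing
    rw [Finset.sum_comm]
    refine Finset.sum_congr rfl fun i _ => ?_
    rw [shift_apply, Finset.mul_sum, Finset.sum_mul]
    refine Finset.sum_congr rfl fun j _ => ?_
    split_ifs <;> simp
  have h2 : pairing m u (shift m v) =
      ∑ j : Fin m, ∑ i : Fin m, if (j : ℕ) + 1 = i then (-1) ^ (j : ℕ) * u j * v i.rev else 0 := by
    unfold pairing
    refine Finset.sum_congr rfl fun j _ => ?_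
    rw [shift_apply, Finset.mul_sum, ← Equiv.sum_comp Fin.revPerm]
    refine Finset.sum_congr rfl fun i _ => ?_
    have hiff : ((i.rev : ℕ) + 1 = j.rev) ↔ ((j : ℕ) + 1 = i) := by
      rw [Fin.val_rev, Fin.val_rev]
      omega
    simp only [Fin.revPerm_apply, hiff]
    split_ifs <;> simp
  rw [h1, h2, ← Finset.sum_neg_distrib]
  refine Finset.sum_congr rfl fun j _ => ?_
  rw [← Finset.sum_neg_distrib]
  refine Finset.sum_congr rfl fun i _ => ?_
  split_ifs with hij
  · rw [← hij, pow_succ]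
    ring
  · simp

theorem K_eq_pairing (m : ℕ) (x y : (Fin 2 → ℂ) × (Fin m → ℂ)) :
    K m x y = (Pi.single 1 (pairing m x.2 y.2), x.1 0 • shift m y.2 - y.1 0 • shift m x.2) := rfl

theorem pairing_smul_right (m : ℕ) (a : ℂ) (u v : Fin m → ℂ) :
    pairing m u (a • v) = a * pairing m u v := by
  simp only [pairing, Pi.smul_apply, smul_eq_mul, Finset.mul_sum]
  exact Finset.sum_congr rfl fun i _ => by ring

theorem pairing_smul_left (m : ℕ) (a : ℂ) (u v : Fin m → ℂ) :
    pairing m (a • u) v = a * pairing m u v := by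
  simp only [pairing, Pi.smul_apply, smul_eq_mul, Finset.mul_sum]
  exact Finset.sum_congr rfl fun i _ => by ring

theorem pairing_zero_left (m : ℕ) (v : Fin m → ℂ) : pairing m 0 v = 0 := by simp [pairing]

theorem pairing_zero_right (m : ℕ) (v : Fin m → ℂ) : pairing m v 0 = 0 := by simp [pairing]

theorem pairing_sub_right (m : ℕ) (u v w : Fin m → ℂ) :
    pairing m u (v - w) = pairing m u v - pairing m u w := by
  simp [pairing, mul_sub, Finset.sum_sub_distrib]

theorem pairing_sub_left (m : ℕ) (u v w : Fin m → ℂ) :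
    pairing m (u - v) w = pairing m u w - pairing m v w := by
  simp [pairing, mul_sub, sub_mul, Finset.sum_sub_distrib]

theorem single_one_inj_eq {a b : ℂ} (h : a = b) :
    (Pi.single 1 a : Fin 2 → ℂ) = Pi.single 1 b := by rw [h]

theorem K_isLeibniz {m : ℕ} (hm : Odd m) : IsLeibniz (K m) := by
  refine isLeibniz_iff.2 ⟨⟨?_, ?_, ?_, ?_⟩, ?_, ?_, ?_, ?_⟩
  · intro x y hx hy
    simp [K_eq_pairing, hx, hy]
  · intro x y hx hy
    simp [K_eq_pairing, hx, pairing_zero_left]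
  · intro x y hx hy
    simp [K_eq_pairing, hy, pairing_zero_right]
  · intro x y hx hy
    simp [K_eq_pairing, hx, hy]
  all_goals
    intro x y z hy hz
    ext1
    · simp only [K_eq_pairing, Prod.fst_sub, Prod.fst_add, ← Pi.single_sub, ← Pi.single_add]
      refine single_one_inj_eq ?_
      simp only [hy, hz, pairing_sub_left, pairing_sub_right, pairing_smul_left,
        pairing_smul_right, pairing_shift, pairing_zero_left, pairing_zero_right, map_zero,
        smul_zero, sub_zero, Pi.zero_apply, zero_mul]
      -- The second alternative is for odd y and z, the only case that needs symmetry of the pairing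
      -- and hence odd m.
      try first
        | ring1
        | (rw [pairing_comm hm y.2 (shift m z.2), pairing_shift]; ring1)
    · simp [K_eq_pairing, hy, hz, smul_smul, mul_comm]

theorem K_isLie {m : ℕ} (hm : Odd m) : IsLie (K m) := by
  refine ⟨K_isLeibniz hm, fun α β x y hx hy => ?_⟩
  rcases zmod_two_cases α with rfl | rfl <;> rcases zmod_two_cases β with rfl | rfl <;>
    simp only [mem_part_zero, mem_part_one] at hx hy
  · simp [K_eq_pairing, hx, hy, pairing_zero_left]
  · simp [K_eq_pairing, hx, hy, pairing_zero_left, pairing_zero_right]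
  · simp [K_eq_pairing, hx, hy, pairing_zero_left, pairing_zero_right]
  · simp [K_eq_pairing, hx, hy, pairing_comm hm x.2]

theorem K_mul_even {m : ℕ} (x y : (Fin 2 → ℂ) × (Fin m → ℂ)) (hx : x.2 = 0) (hy : y.2 = 0) :
    K m x y = 0 := by
  simp [K_eq_pairing, hx, hy, pairing_zero_left]

theorem K_lowerCentral_coord (m k : ℕ) : ∀ x ∈ lowerCentral (K m) (k + 1),
    x.1 0 = 0 ∧ ∀ i : Fin m, (i : ℕ) < k + 1 → x.2 i = 0 := by
  let P : ℕ → Submodule ℂ ((Fin 2 → ℂ) × (Fin m → ℂ)) := fun k =>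
    { carrier := {x | x.1 0 = 0 ∧ ∀ i : Fin m, (i : ℕ) < k → x.2 i = 0}
      zero_mem' := ⟨rfl, fun _ _ => rfl⟩
      add_mem' := fun {a b} ha hb => ⟨by simp [ha.1, hb.1], fun i hi => by
        simp [ha.2 i hi, hb.2 i hi]⟩
      smul_mem' := fun c a ha => ⟨by simp [ha.1], fun i hi => by simp [ha.2 i hi]⟩ }
  have hshift : ∀ (k : ℕ) (u : Fin m → ℂ), (∀ i : Fin m, (i : ℕ) < k → u i = 0) →
      ∀ i : Fin m, (i : ℕ) < k + 1 → shift m u i = 0 := by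
    intro k u hu i hi
    rw [shift_apply]
    refine Finset.sum_eq_zero fun j _ => ?_
    split_ifs with hj
    · exact hu j (by omega)
    · rfl
  have hle : ∀ k, lowerCentral (K m) (k + 1) ≤ P (k + 1) := by
    intro k
    induction k with
    | zero =>
      refine lowerCentral_succ_le_of fun x _ y => ⟨by simp [K_eq_pairing], fun i hi => ?_⟩
      have h0 := hshift 0 x.2 (by simp) i hi
      have h1 := hshift 0 y.2 (by simp) i hi
      simp [K_eq_pairing, h0, h1]
    | succ k ih =>
      refine lowerCentral_succ_le_of fun x hx y => ⟨by simp [K_eq_pairing], fun i hi => ?_⟩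
      obtain ⟨hx0, hx1⟩ := ih hx
      simp [K_eq_pairing, hx0, hshift _ _ hx1 i hi]
  exact fun x hx => hle k hx

theorem K_isNilpotent (m : ℕ) : IsNilpotent (K m) := by
  -- Only multiples of X₁ can survive in Cᵐ⁺¹, and one more product kills them. The exponent need
  -- not be sharp.
  refine ⟨m + 2, le_bot_iff.1 (lowerCentral_succ_le_of fun x hx y => ?_)⟩
  obtain ⟨h0, h1⟩ := K_lowerCentral_coord m m x hx
  have h2 : x.2 = 0 := funext fun i => h1 i (by omega)
  simp [K_eq_pairing, h0, h2, pairing_zero_left]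

theorem single_mem_K_lowerCentral (m k : ℕ) (hk : k < m) :
    ((0 : Fin 2 → ℂ), (Pi.single ⟨k, hk⟩ 1 : Fin m → ℂ)) ∈ lowerCentral (K m) k := by
  induction k with
  | zero => trivial
  | succ k ih =>
    have hmul := mul_mem_lowerCentral_succ (ih (by omega)) (-Pi.single 0 1, 0)
    have heq : K m (0, Pi.single ⟨k, by omega⟩ 1) (-Pi.single 0 1, 0) =
        (0, Pi.single ⟨k + 1, hk⟩ 1) := by
      simp [K_eq_pairing, pairing_zero_right, shift_single m k hk]
    rwa [heq] at hmul

theorem K_lowerCentral_ne_bot (m : ℕ) (hm : 1 ≤ m) : lowerCentral (K m) m ≠ ⊥ := by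
  obtain ⟨n, rfl⟩ : ∃ n, m = n + 1 := ⟨m - 1, by omega⟩
  intro hbot
  -- Y_m lies in Cᵐ⁻¹, so [Y_m, Y₁] = ±X₁ is a nonzero element of Cᵐ.
  have hmem := mul_mem_lowerCentral_succ (single_mem_K_lowerCentral (n + 1) n (by omega))
    (0, Pi.single 0 1)
  rw [hbot, Submodule.mem_bot] at hmem
  have h1 := congrFun (congrArg Prod.fst hmem) 1
  have h2 : pairing (n + 1) (Pi.single ⟨n, by omega⟩ 1) (Pi.single 0 1) = (-1) ^ n := by
    unfold pairing
    rw [Finset.sum_eq_single ⟨n, by omega⟩]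
    · have : (⟨n, by omega⟩ : Fin (n + 1)).rev = 0 := by ext; simp [Fin.val_rev]
      simp [this]
    · intro i _ hi
      simp [Pi.single_eq_of_ne hi]
    · simp
  simp [K_eq_pairing, h2] at h1

theorem mem_M_of_forall {n m k : ℕ} {μ : StdLaw n m} (hμ : μ ∈ N n m)
    (hne : lowerCentral μ k ≠ ⊥) (hbd : ∀ ν ∈ N n m, lowerCentral ν (k + 1) = ⊥) : μ ∈ M n m := by
  refine ⟨hμ, ⟨μ, hμ, rfl⟩, ?_⟩
  rintro _ ⟨ν, hν, rfl⟩
  have h1 := lt_nilindex hμ.2 hne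
  have h2 := nilindex_le (hbd ν hν)
  omega

/-- A law of type `(2, m + 1)` isomorphic to `K^{2,m} ⊕ ℂ`. -/
theorem exists_law_isomorphic_directSum (m : ℕ) (hm : Odd m) :
    ∃ μ : StdLaw 2 (m + 1), Isomorphic μ (directSum (K m) oddLine) ∧ μ ∈ N 2 (m + 1) ∧
      lowerCentral μ m ≠ ⊥ ∧
      ∀ x y : (Fin 2 → ℂ) × (Fin (m + 1) → ℂ), x.2 = 0 → y.2 = 0 → μ x y = 0 := by
  -- Any linear identifications serve: the law is transported along them.
  let f₀ : (Fin 2 → ℂ) ≃ₗ[ℂ] (Fin 2 → ℂ) × (Fin 0 → ℂ) :=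
    LinearEquiv.ofFinrankEq _ _ (by simp)
  let f₁ : (Fin (m + 1) → ℂ) ≃ₗ[ℂ] (Fin m → ℂ) × (Fin 1 → ℂ) :=
    LinearEquiv.ofFinrankEq _ _ (by simp)
  let F := f₀.prodCongr f₁
  let μ : StdLaw 2 (m + 1) :=
    ((directSum (K m) oddLine).compl₁₂ F.toLinearMap F.toLinearMap).compr₂ F.symm.toLinearMap
  have hF : ∀ x y, F (μ x y) = directSum (K m) oddLine (F x) (F y) := fun x y =>
    F.apply_symm_apply _
  let G : (Fin 2 → ℂ) × (Fin (m + 1) → ℂ) →ₗ[ℂ] (Fin 2 → ℂ) × (Fin m → ℂ) :=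
    ((LinearMap.fst ℂ (Fin 2 → ℂ) (Fin 0 → ℂ)).comp f₀.toLinearMap).prodMap
      ((LinearMap.fst ℂ (Fin m → ℂ) (Fin 1 → ℂ)).comp f₁.toLinearMap)
  let H : (Fin 2 → ℂ) × (Fin (m + 1) → ℂ) →ₗ[ℂ] (Fin 0 → ℂ) × (Fin 1 → ℂ) :=
    ((LinearMap.snd ℂ (Fin 2 → ℂ) (Fin 0 → ℂ)).comp f₀.toLinearMap).prodMap
      ((LinearMap.snd ℂ (Fin m → ℂ) (Fin 1 → ℂ)).comp f₁.toLinearMap)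
  have hG : ∀ x y, G (μ x y) = K m (G x) (G y) := fun x y =>
    Prod.ext (congrArg (fun w => w.1.1) (hF x y)) (congrArg (fun w => w.2.1) (hF x y))
  have hH : ∀ x y, H (μ x y) = 0 := fun x y =>
    Prod.ext (congrArg (fun w => w.1.2) (hF x y)) (congrArg (fun w => w.2.2) (hF x y))
  -- An identity may be checked after `G`, where it becomes one in K, and after `H`, where all
  -- products vanish.
  have hinj : ∀ x y, G x = G y → H x = H y → x = y := fun x y h1 h2 =>
    F.injective (Prod.ext
      (Prod.ext (congrArg (fun w => w.1) h1 : (F x).1.1 = (F y).1.1)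
        (congrArg (fun w => w.1) h2 : (F x).1.2 = (F y).1.2))
      (Prod.ext (congrArg (fun w => w.2) h1 : (F x).2.1 = (F y).2.1)
        (congrArg (fun w => w.2) h2 : (F x).2.2 = (F y).2.2)))
  have hGsurj : Function.Surjective G := by
    intro w
    obtain ⟨a, ha⟩ := f₀.surjective (w.1, 0)
    obtain ⟨b, hb⟩ := f₁.surjective (w.2, 0)
    exact ⟨(a, b), Prod.ext (by simp [G, ha]) (by simp [G, hb])⟩
  have hmap := map_lowerCentral (μ := μ) (ν := K m) hGsurj hG
  have hG0 : ∀ x : (Fin 2 → ℂ) × (Fin (m + 1) → ℂ), x.1 = 0 → (G x).1 = 0 := by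
    intro x hx; simp [G, hx]
  have hG1 : ∀ x : (Fin 2 → ℂ) × (Fin (m + 1) → ℂ), x.2 = 0 → (G x).2 = 0 := by
    intro x hx; simp [G, hx]
  have hfst : ∀ x : (Fin 2 → ℂ) × (Fin (m + 1) → ℂ), (G x).1 = 0 → (H x).1 = 0 → x.1 = 0 :=
    fun x h1 h2 => f₀.map_eq_zero_iff.1 (Prod.ext h1 h2)
  have hsnd : ∀ x : (Fin 2 → ℂ) × (Fin (m + 1) → ℂ), (G x).2 = 0 → (H x).2 = 0 → x.2 = 0 :=
    fun x h1 h2 => f₁.map_eq_zero_iff.1 (Prod.ext h1 h2)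
  have hK := K_isLeibniz hm
  have hLeib : IsLeibniz μ := by
    refine isLeibniz_iff.2 ⟨⟨fun x y hx hy => hsnd _ ?_ (by rw [hH]; rfl),
      fun x y hx hy => hfst _ ?_ (by rw [hH]; rfl), fun x y hx hy => hfst _ ?_ (by rw [hH]; rfl),
      fun x y hx hy => hsnd _ ?_ (by rw [hH]; rfl)⟩,
      fun x y z hy hz => hinj _ _ ?_ ?_, fun x y z hy hz => hinj _ _ ?_ ?_,
      fun x y z hy hz => hinj _ _ ?_ ?_, fun x y z hy hz => hinj _ _ ?_ ?_⟩
    · rw [hG]; exact hK.even_even (hG1 x hx) (hG1 y hy)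
    · rw [hG]; exact hK.even_odd (hG1 x hx) (hG0 y hy)
    · rw [hG]; exact hK.odd_even (hG0 x hx) (hG1 y hy)
    · rw [hG]; exact hK.odd_odd (hG0 x hx) (hG0 y hy)
    · simp only [map_sub, hG]; exact hK.identity_even_even _ (hG1 y hy) (hG1 z hz)
    · simp only [map_sub, hH, sub_zero]
    · simp only [map_sub, hG]; exact hK.identity_even_odd _ (hG1 y hy) (hG0 z hz)
    · simp only [map_sub, hH, sub_zero]
    · simp only [map_sub, hG]; exact hK.identity_odd_even _ (hG0 y hy) (hG1 z hz)
    · simp only [map_sub, hH, sub_zero]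
    · simp only [map_add, hG]; exact hK.identity_odd_odd _ (hG0 y hy) (hG0 z hz)
    · simp only [map_add, hH, add_zero]
  have hnil : IsNilpotent μ := by
    obtain ⟨k, hk⟩ := K_isNilpotent m
    refine ⟨k + 1, le_bot_iff.1 (lowerCentral_succ_le_of fun x hx y => ?_)⟩
    have hGx : G x = 0 := by
      have h1 : G x ∈ (lowerCentral μ k).map G := Submodule.mem_map_of_mem hx
      rwa [hmap, hk, Submodule.mem_bot] at h1
    exact (Submodule.mem_bot ℂ).2 (hinj _ _ (by simp [hG, hGx]) (by simp [hH]))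
  refine ⟨μ, ⟨f₀, f₁, hF⟩, ⟨hLeib, hnil⟩, ?_, ?_⟩
  · intro hbot
    refine K_lowerCentral_ne_bot m hm.pos ?_
    rw [← hmap, hbot, Submodule.map_bot]
  · intro x y hx hy
    exact hinj _ _ (by rw [hG, K_mul_even _ _ (hG1 x hx) (hG1 y hy), map_zero])
      (by rw [hH, map_zero])

end Model

end LeibnizSuper

theorem theorem6p7 (m : ℕ) (hm : 5 ≤ m) :
    ¬ (LeibnizSuper.M 2 m ⊆ LeibnizSuper.ZF 2 m) ∧
    (Odd m → LeibnizSuper.IsLie (LeibnizSuper.K m) ∧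
      LeibnizSuper.K m ∈ LeibnizSuper.M 2 m ∧ LeibnizSuper.K m ∉ LeibnizSuper.ZF 2 m) ∧
    (Even m → ∃ μ : LeibnizSuper.StdLaw 2 m,
      LeibnizSuper.Isomorphic μ
        (LeibnizSuper.directSum (LeibnizSuper.K (m - 1)) LeibnizSuper.oddLine) ∧
      μ ∈ LeibnizSuper.M 2 m ∧ μ ∉ LeibnizSuper.ZF 2 m) := by
  have hodd : Odd m → LeibnizSuper.IsLie (LeibnizSuper.K m) ∧
      LeibnizSuper.K m ∈ LeibnizSuper.M 2 m ∧ LeibnizSuper.K m ∉ LeibnizSuper.ZF 2 m := by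
    intro ho
    refine ⟨LeibnizSuper.K_isLie ho, LeibnizSuper.mem_M_of_forall
      ⟨LeibnizSuper.K_isLeibniz ho, LeibnizSuper.K_isNilpotent m⟩
      (LeibnizSuper.K_lowerCentral_ne_bot m (by omega))
      fun ν hν => hν.1.lowerCentral_succ_eq_bot hν.2 hm (by simp) (by simp), fun hZ => ?_⟩
    exact LeibnizSuper.not_hasSNilindex_of_even_mul_eq_zero le_rfl LeibnizSuper.K_mul_even hZ.2
  have heven : Even m → ∃ μ : LeibnizSuper.StdLaw 2 m,
      LeibnizSuper.Isomorphic μ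
        (LeibnizSuper.directSum (LeibnizSuper.K (m - 1)) LeibnizSuper.oddLine) ∧
      μ ∈ LeibnizSuper.M 2 m ∧ μ ∉ LeibnizSuper.ZF 2 m := by
    intro he
    obtain ⟨n, rfl⟩ : ∃ n, m = n + 1 := ⟨m - 1, by omega⟩
    have hn : Odd n := by
      rw [← Nat.not_even_iff_odd]
      exact Nat.even_add_one.1 he
    obtain ⟨μ, hiso, hN, hne, hmul⟩ := LeibnizSuper.exists_law_isomorphic_directSum n hn
    exact ⟨μ, hiso, LeibnizSuper.mem_M_of_forall hN hne fun ν hν =>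
      hν.1.lowerCentral_eq_bot_of_even hν.2 hm (by simp) (by simp) he,
      fun hZ => LeibnizSuper.not_hasSNilindex_of_even_mul_eq_zero le_rfl hmul hZ.2⟩
  refine ⟨fun hsub => ?_, hodd, heven⟩
  rcases Nat.even_or_odd m with he | ho
  · obtain ⟨μ, -, hM, hZ⟩ := heven he
    exact hZ (hsub hM)
  · exact (hodd ho).2.2 (hsub (hodd ho).2.1)
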